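/- A skew (left) brace is a set $B$ with two group structures $(B,+)$ and $(B,\cdot)$, neither assumed abelian, such that $a(b+c)=ab-a+ac$ for all $a,b,c\in B$; put $\lambda_a(b)=-a+ab$. The two groups have the same identity $0$. An ideal of $B$ is a subset that is a normal subgroup of both $(B,+)$ and $(B,\cdot)$ and is invariant under every $\lambda_b$, $b\in B$; an ideal $I$ is itself a skew brace, and $B/I$ is a skew brace. Let $\operatorname{Soc}(B)=\operatorname{Ker}\lambda\cap Z(B,+)$ and $\zeta(B)=\operatorname{Soc}(B)\cap Z(B,\cdot)$. The skew brace $B$ is supersoluble if it has a finite chain of ideals $\{0\}=I_0\le I_1\le\dots\le I_n=B$ such that, for each $0\le i<n$, either $(I_{i+1}/I_i,+)$ is infinite cyclic and $I_{i+1}/I_i\le\operatorname{Soc}(B/I_i)$, or $I_{i+1}/I_i$ has prime order. An ideal $I$ of $B$ is $B$-centrally nilpotent if there is a finite chain of ideals of $B$, $\{0\}=I_0\le I_1\le\dots\le I_n=I$, with $I_{i+1}/I_i\le\zeta(I/I_i)$ for all $0\le i<n$. The Fitting ideal $\operatorname{Fit}(B)$ is the sum of all $B$-centrally nilpotent ideals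 of $B$. Let $U_2^+(B)$ be the set of all elements of finite odd order in $(B,+)$. **Theorem.** Let $B$ be a supersoluble skew brace such that $U_2^+(B)=\{0\}$. Then $B/\operatorname{Fit}(B)$ is finite and $|B/\operatorname{Fit}(B)|$ is a power of $2$. In particular, this holds if $B$ is supersoluble and $(B,+)$ is torsion-free (that is, $0$ is its only element of finite order). -/

import Mathlib

/-- A skew left brace: a set with two group structures `(B, +)` (not necessarily abelian) and
`(B, *)` such that `a * (b + c) = a * b - a + a * c`. -/
class SkewBrace (B : Type*) extends AddGroup B, Group B where
  mul_add_eq : ∀ a b c : B, a * (b + c) = a * b - a + a * c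

namespace SkewBrace

section Basic

variable {B : Type*} [SkewBrace B]

/-- The map `lam a b = -a + a * b`, usually written `λ_a(b)`. -/
def lam (a b : B) : B := -a + a * b

theorem mul_eq_add_lam (a b : B) : a * b = a + lam a b := by
  simp [lam]

theorem one_eq_zero : (1 : B) = 0 := by
  have h := mul_add_eq (1 : B) 0 0
  simp only [add_zero, one_mul, zero_sub] at h
  exact neg_eq_zero.mp h.symm

theorem lam_add (a b c : B) : lam a (b + c) = lam a b + lam a c := by
  simp only [lam, mul_add_eq, sub_eq_add_neg, add_assoc]

theorem mul_zero_eq (a : B) : a * (0 : B) = a := by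
  rw [← one_eq_zero, mul_one]

theorem lam_zero (a : B) : lam a (0 : B) = 0 := by
  simp [lam, mul_zero_eq]

theorem lam_neg (a b : B) : lam a (-b) = -lam a b := by
  apply eq_neg_of_add_eq_zero_left
  rw [← lam_add, neg_add_cancel, lam_zero]

theorem lam_mul (a b c : B) : lam (a * b) c = lam a (lam b c) := by
  have h : a * b + lam (a * b) c = a * b + lam a (lam b c) := by
    rw [← mul_eq_add_lam, mul_assoc, mul_eq_add_lam b c, mul_eq_add_lam a (b + _), lam_add,
      ← add_assoc, ← mul_eq_add_lam]
  exact add_left_cancel h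

theorem lam_one (c : B) : lam (1 : B) c = c := by
  simp [lam, one_eq_zero (B := B) ▸ one_mul c, one_eq_zero]

theorem lam_lam_inv (a c : B) : lam a (lam a⁻¹ c) = c := by
  rw [← lam_mul, mul_inv_cancel, lam_one]

theorem inv_eq_lam (a : B) : a⁻¹ = lam a⁻¹ (-a) := by
  have h : a⁻¹ + lam a⁻¹ a = 0 := by
    rw [← mul_eq_add_lam, inv_mul_cancel, one_eq_zero]
  rw [lam_neg]
  exact eq_neg_of_add_eq_zero_left h

theorem add_eq_mul (a b : B) : a + b = a * lam a⁻¹ b := by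
  rw [mul_eq_add_lam, lam_lam_inv]

variable (B) in
/-- The socle `Soc(B) = Ker λ ∩ Z(B, +)`. -/
def socle : Set B := {a | ∀ b : B, lam a b = b} ∩ (AddSubgroup.center B : Set B)

variable (B) in
/-- The centre `ζ(B) = Soc(B) ∩ Z(B, *)`. -/
def zeta : Set B := socle B ∩ (Subgroup.center B : Set B)

variable (B) in
/-- `U_p^+(B)`: the elements whose additive order is finite and divisible only by primes
larger than `p`. -/
def addU (p : ℕ) : Set B :=
  {b | IsOfFinAddOrder b ∧ ∀ q : ℕ, q.Prime → q ∣ addOrderOf b → p < q}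

end Basic

/-- An ideal of a skew brace: a subgroup of `(B, +)` and of `(B, *)` that is normal in both groups
and invariant under all the maps `λ_b`. -/
structure BraceIdeal (B : Type*) [SkewBrace B] extends AddSubgroup B where
  mul_mem : ∀ {a b : B}, a ∈ carrier → b ∈ carrier → a * b ∈ carrier
  inv_mem : ∀ {a : B}, a ∈ carrier → a⁻¹ ∈ carrier
  lam_mem : ∀ (b : B) {a : B}, a ∈ carrier → lam b a ∈ carrier
  add_conj_mem : ∀ (b : B) {a : B}, a ∈ carrier → b + a + -b ∈ carrier
  mul_conj_mem : ∀ (b : B) {a : B}, a ∈ carrier → b * a * b⁻¹ ∈ carrier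

namespace BraceIdeal

variable {B : Type*} [SkewBrace B]

instance : SetLike (BraceIdeal B) B where
  coe I := I.carrier
  coe_injective I J h := by
    cases I; cases J; congr; exact SetLike.coe_injective h

instance : PartialOrder (BraceIdeal B) := PartialOrder.ofSetLike (BraceIdeal B) B

instance (I : BraceIdeal B) : I.toAddSubgroup.Normal :=
  ⟨fun _ ha b => I.add_conj_mem b ha⟩

/-- The multiplicative subgroup underlying an ideal. -/
def toMulSubgroup (I : BraceIdeal B) : Subgroup B where
  carrier := I.carrier
  mul_mem' := I.mul_mem
  one_mem' := by rw [one_eq_zero]; exact I.zero_mem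
  inv_mem' := I.inv_mem

/-- An ideal is itself a skew brace, with the restricted operations. -/
instance (I : BraceIdeal B) : SkewBrace I where
  toAddGroup := inferInstanceAs (AddGroup I.toAddSubgroup)
  toGroup := inferInstanceAs (Group I.toMulSubgroup)
  mul_add_eq a b c := Subtype.ext (SkewBrace.mul_add_eq (a : B) b c)

/-- `J ∩ I`, as an ideal of the skew brace `I`. -/
def restrict (J I : BraceIdeal B) : BraceIdeal I where
  carrier := {x | (x : B) ∈ J}
  add_mem' := fun ha hb => J.add_mem ha hb
  zero_mem' := J.zero_mem
  neg_mem' := fun ha => J.neg_mem ha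
  mul_mem := fun ha hb => J.mul_mem ha hb
  inv_mem := fun ha => J.inv_mem ha
  lam_mem := fun b _ ha => J.lam_mem (b : B) ha
  add_conj_mem := fun b _ ha => J.add_conj_mem (b : B) ha
  mul_conj_mem := fun b _ ha => J.mul_conj_mem (b : B) ha

/-- The underlying type of the quotient `B / I`: the additive cosets `b + I = bI`. -/
def Quot (I : BraceIdeal B) : Type _ := B ⧸ I.toAddSubgroup

instance (I : BraceIdeal B) : AddGroup I.Quot :=
  inferInstanceAs (AddGroup (B ⧸ I.toAddSubgroup))

/-- The projection `B → B / I`. -/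
def proj (I : BraceIdeal B) : B →+ I.Quot := QuotientAddGroup.mk' I.toAddSubgroup

theorem proj_surjective (I : BraceIdeal B) : Function.Surjective I.proj :=
  QuotientAddGroup.mk'_surjective _

theorem proj_eq_proj (I : BraceIdeal B) {a b : B} : I.proj a = I.proj b ↔ -a + b ∈ I :=
  QuotientAddGroup.eq

/-- Additive cosets and multiplicative cosets of an ideal agree. -/
theorem proj_eq_proj_mul (I : BraceIdeal B) {a b : B} : I.proj a = I.proj b ↔ a⁻¹ * b ∈ I := by
  rw [proj_eq_proj]
  have h : -a + b = lam a (a⁻¹ * b) := by simp [lam]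
  have h2 : a⁻¹ * b = lam a⁻¹ (-a + b) := by
    rw [h, ← lam_mul, inv_mul_cancel, lam_one]
  constructor
  · intro h3; rw [h2]; exact I.lam_mem _ h3
  · intro h3; rw [h]; exact I.lam_mem _ h3

theorem proj_mul_congr (I : BraceIdeal B) {a a' b b' : B} (ha : I.proj a = I.proj a')
    (hb : I.proj b = I.proj b') : I.proj (a * b) = I.proj (a' * b') := by
  rw [proj_eq_proj_mul] at *
  have h : (a * b)⁻¹ * (a' * b') = b⁻¹ * (a⁻¹ * a') * b⁻¹⁻¹ * (b⁻¹ * b') := by group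
  rw [h]
  exact I.mul_mem (I.mul_conj_mem _ ha) hb

theorem proj_inv_congr (I : BraceIdeal B) {a a' : B} (ha : I.proj a = I.proj a') :
    I.proj a⁻¹ = I.proj a'⁻¹ := by
  rw [proj_eq_proj_mul] at *
  have h : a⁻¹⁻¹ * a'⁻¹ = a * (a⁻¹ * a')⁻¹ * a⁻¹ := by group
  rw [h]
  exact I.mul_conj_mem _ (I.inv_mem ha)

instance (I : BraceIdeal B) : Mul I.Quot :=
  ⟨Quotient.map₂ (· * ·) fun _ _ ha _ _ hb =>
    Quotient.exact (I.proj_mul_congr (Quotient.sound ha) (Quotient.sound hb))⟩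

instance (I : BraceIdeal B) : Inv I.Quot :=
  ⟨Quotient.map (·⁻¹) fun _ _ ha => Quotient.exact (I.proj_inv_congr (Quotient.sound ha))⟩

instance (I : BraceIdeal B) : One I.Quot := ⟨I.proj 1⟩

theorem proj_mul (I : BraceIdeal B) (a b : B) : I.proj (a * b) = I.proj a * I.proj b := rfl

theorem proj_inv (I : BraceIdeal B) (a : B) : I.proj a⁻¹ = (I.proj a)⁻¹ := rfl

theorem proj_one (I : BraceIdeal B) : I.proj 1 = 1 := rfl

/-- The quotient skew brace `B / I`. -/
instance (I : BraceIdeal B) : SkewBrace I.Quot where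
  toAddGroup := inferInstance
  toGroup := Group.ofLeftAxioms
    (fun a b c => by
      obtain ⟨a, rfl⟩ := I.proj_surjective a
      obtain ⟨b, rfl⟩ := I.proj_surjective b
      obtain ⟨c, rfl⟩ := I.proj_surjective c
      simp only [← proj_mul, mul_assoc])
    (fun a => by
      obtain ⟨a, rfl⟩ := I.proj_surjective a
      rw [← proj_one, ← proj_mul, one_mul])
    (fun a => by
      obtain ⟨a, rfl⟩ := I.proj_surjective a
      rw [← proj_inv, ← proj_mul, inv_mul_cancel, proj_one])
  mul_add_eq a b c := by
    obtain ⟨a, rfl⟩ := I.proj_surjective a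
    obtain ⟨b, rfl⟩ := I.proj_surjective b
    obtain ⟨c, rfl⟩ := I.proj_surjective c
    change I.proj (a * (b + c)) = I.proj (a * b) - I.proj a + I.proj (a * c)
    rw [SkewBrace.mul_add_eq, map_add, map_sub]

/-- For ideals `I ≤ J`, the additive group of `J / I`, as a subgroup of `(B / I, +)`. -/
def factor (J I : BraceIdeal B) : AddSubgroup I.Quot := J.toAddSubgroup.map I.proj

/-- An ideal `I` is `B`-centrally nilpotent if there is a chain of ideals of `B`
`0 = c 0 ≤ c 1 ≤ ⋯ ≤ c n = I` with `c (i+1) / c i ≤ ζ(I / c i)` for all `i < n`. -/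
def IsBCentrallyNilpotent (I : BraceIdeal B) : Prop :=
  ∃ (n : ℕ) (c : ℕ → BraceIdeal B),
    (c 0 : Set B) = {0} ∧ c n = I ∧
    ∀ i < n, c i ≤ c (i + 1) ∧
      ∀ x : I, (x : B) ∈ c (i + 1) → ((c i).restrict I).proj x ∈ zeta ((c i).restrict I).Quot

variable (B) in
/-- The additive subgroup generated by all the `B`-centrally nilpotent ideals of `B`. -/
def fitAddSubgroup : AddSubgroup B :=
  ⨆ (I : BraceIdeal B) (_ : I.IsBCentrallyNilpotent), I.toAddSubgroup

theorem le_fit {I : BraceIdeal B} (h : I.IsBCentrallyNilpotent) {x : B} (hx : x ∈ I) :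
    x ∈ fitAddSubgroup B :=
  (le_iSup₂_of_le I h le_rfl : I.toAddSubgroup ≤ fitAddSubgroup B) hx

theorem fit_induction {p : B → Prop} (h0 : p 0) (hadd : ∀ x y, p x → p y → p (x + y))
    (hI : ∀ I : BraceIdeal B, I.IsBCentrallyNilpotent → ∀ x ∈ I, p x) {x : B}
    (hx : x ∈ fitAddSubgroup B) : p x := by
  unfold fitAddSubgroup at hx
  rw [iSup_subtype'] at hx
  exact AddSubgroup.iSup_induction (C := p) _ hx (fun I x hx => hI I.1 I.2 x hx) h0 hadd

theorem fit_lam_mem (b : B) {a : B} (ha : a ∈ fitAddSubgroup B) :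
    lam b a ∈ fitAddSubgroup B := by
  refine fit_induction (p := fun a => lam b a ∈ fitAddSubgroup B) ?_ ?_ ?_ ha
  · rw [lam_zero]; exact zero_mem _
  · intro x y hx hy; rw [lam_add]; exact add_mem hx hy
  · intro I h x hx; exact le_fit h (I.lam_mem b hx)

theorem fit_mul_mem {a b : B} (ha : a ∈ fitAddSubgroup B) (hb : b ∈ fitAddSubgroup B) :
    a * b ∈ fitAddSubgroup B := by
  rw [mul_eq_add_lam]; exact add_mem ha (fit_lam_mem a hb)

theorem fit_mul_conj_mem (b : B) {a : B} (ha : a ∈ fitAddSubgroup B) :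
    b * a * b⁻¹ ∈ fitAddSubgroup B := by
  have key : ∀ c : B, b * lam c a * b⁻¹ ∈ fitAddSubgroup B := by
    refine fit_induction (p := fun a => ∀ c : B, b * lam c a * b⁻¹ ∈ fitAddSubgroup B)
      ?_ ?_ ?_ ha
    · intro c
      rw [lam_zero, mul_zero_eq, mul_inv_cancel, one_eq_zero]
      exact zero_mem _
    · intro x y hx hy c
      have h : b * lam c (x + y) * b⁻¹ =
          (b * lam c x * b⁻¹) * (b * lam ((lam c x)⁻¹ * c) y * b⁻¹) := by
        rw [lam_add, add_eq_mul, lam_mul]; group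
      rw [h]
      exact fit_mul_mem (hx c) (hy _)
    · intro I h x hx c
      exact le_fit h (I.mul_conj_mem b (I.lam_mem c hx))
  simpa [lam_one] using key 1

variable (B) in
/-- The Fitting ideal `Fit(B)`: the sum of all the `B`-centrally nilpotent ideals of `B`. -/
def fit : BraceIdeal B where
  toAddSubgroup := fitAddSubgroup B
  mul_mem := fit_mul_mem
  inv_mem := fun {a} ha => by
    rw [inv_eq_lam]; exact fit_lam_mem _ (neg_mem ha)
  lam_mem := fun b _ ha => fit_lam_mem b ha
  add_conj_mem := fun b {a} ha => by
    refine fit_induction (p := fun a => b + a + -b ∈ fitAddSubgroup B) ?_ ?_ ?_ ha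
    · simp
    · intro x y hx hy
      have h : b + (x + y) + -b = (b + x + -b) + (b + y + -b) := by
        simp [add_assoc]
      rw [h]; exact add_mem hx hy
    · intro I h x hx; exact le_fit h (I.add_conj_mem b hx)
  mul_conj_mem := fun b _ ha => fit_mul_conj_mem b ha

end BraceIdeal

/-- A skew brace `B` is supersoluble if it has a finite chain of ideals
`0 = c 0 ≤ c 1 ≤ ⋯ ≤ c n = B` such that, for each `i < n`, either `c (i+1) / c i` has infinite
cyclic additive group and lies in `Soc(B / c i)`, or `c (i+1) / c i` has prime order. -/
def IsSupersoluble (B : Type*) [SkewBrace B] : Prop :=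
  ∃ (n : ℕ) (c : ℕ → BraceIdeal B),
    (c 0 : Set B) = {0} ∧ (c n : Set B) = Set.univ ∧
    ∀ i < n, c i ≤ c (i + 1) ∧
      ((Infinite ((c (i + 1)).factor (c i)) ∧ IsAddCyclic ((c (i + 1)).factor (c i)) ∧
          ((c (i + 1)).factor (c i) : Set (c i).Quot) ⊆ socle (c i).Quot) ∨
        (Nat.card ((c (i + 1)).factor (c i))).Prime)

end SkewBrace

/-!
A factor of odd prime order `p` can be exchanged with the factor below it in a supersoluble chain,
because an extension by it of a group of order two, or of an infinite cyclic socle factor, is an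
abelian ideal: this ideal either splits or is again infinite cyclic and contained in the socle.
Without elements of order `p` the factor of order `p` cannot reach the bottom of the chain, so it is
absorbed on the way down, and there remains a chain from `0` to `B` with factors that are infinite
cyclic or of order two.

A factor of order two is central. An infinite cyclic socle factor is acted on by `λ` through `±1`,
so every square `b * b` acts trivially on it; an ideal all of whose elements act trivially on all
these factors is therefore `B`-centrally nilpotent. To find such an ideal of index a power of two,
replace each infinite cyclic factor by its doubles, leaving a factor of order two above, and move
the latter factors to the top of the chain. Modulo the ideal below, `2 • y = y * y` is a square.
-/

section Group

theorem mem_of_pow_mem_of_odd {G : Type*} [Group G] {H : Subgroup G} (hsq : ∀ x, x * x ∈ H)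
    {n : ℕ} (hn : Odd n) {x : G} (hx : x ^ n ∈ H) : x ∈ H := by
  obtain ⟨m, rfl⟩ := hn
  rw [pow_succ, pow_mul, sq] at hx
  exact (H.mul_mem_cancel_left (H.pow_mem (hsq x) m)).1 hx

variable {A : Type*} [AddGroup A]

open AddSubgroup

theorem addOrderOf_eq_zero_iff_forall_zsmul {g : A} :
    addOrderOf g = 0 ↔ ∀ n : ℤ, n • g = 0 → n = 0 := by
  refine ⟨fun hg n hn => ?_, fun h => ?_⟩
  · rwa [← addOrderOf_dvd_iff_zsmul_eq_zero, hg, Nat.cast_zero, zero_dvd_iff] at hn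
  · exact Int.natCast_eq_zero.1 (h _ (by rw [natCast_zsmul, addOrderOf_nsmul_eq_zero]))

theorem eq_zero_of_nsmul_eq_zero_of_mem_zmultiples {g x : A} (hg : addOrderOf g = 0) {n : ℕ}
    (hn : n ≠ 0) (hx : x ∈ zmultiples g) (h : n • x = 0) : x = 0 := by
  obtain ⟨m, rfl⟩ := mem_zmultiples_iff.1 hx
  rw [← natCast_zsmul, ← mul_zsmul] at h
  have hm : m = 0 := (mul_eq_zero_iff_left (Int.natCast_ne_zero.2 hn)).1
    (addOrderOf_eq_zero_iff_forall_zsmul.1 hg _ h)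
  rw [hm, zero_zsmul]

theorem addOrderOf_nsmul_eq_zero_of_ne_zero {g : A} (hg : addOrderOf g = 0) {n : ℕ} (hn : n ≠ 0) :
    addOrderOf (n • g) = 0 := by
  rw [addOrderOf_eq_zero_iff] at hg ⊢
  exact fun h => hg (h.of_nsmul hn)

theorem zsmul_nsmul_comm (g : A) (m : ℤ) (n : ℕ) : m • n • g = n • m • g := by
  rw [← natCast_zsmul, ← natCast_zsmul, zsmul_comm]

theorem relIndex_zmultiples_nsmul {g : A} (hg : addOrderOf g = 0) (n : ℕ) :
    (zmultiples (n • g)).relIndex (zmultiples g) = n := by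
  have hinj : Function.Injective (zmultiplesHom A g) :=
    injective_zsmul_iff_not_isOfFinAddOrder.2 (addOrderOf_eq_zero_iff.1 hg)
  have hn : zmultiples (n • g) = (zmultiples (n : ℤ)).map (zmultiplesHom A g) := by
    simp [AddMonoidHom.map_zmultiples]
  have hg : zmultiples g = (⊤ : AddSubgroup ℤ).map (zmultiplesHom A g) := by
    rw [← AddMonoidHom.range_eq_map, range_zmultiplesHom]
  rw [hn, hg, relIndex_map_map_of_injective _ _ hinj, relIndex_top_right, Int.index_zmultiples,
    Int.natAbs_natCast]

theorem exists_zmultiples_eq_of_relIndex_eq_prime {J : AddSubgroup A} {k x : A} {p : ℕ} {m : ℤ}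
    (hp : p.Prime) (hk : addOrderOf k = 0) (hJ : (zmultiples k).relIndex J = p) (hkJ : k ∈ J)
    (hxJ : x ∈ J) (hxk : AddCommute x k) (hpx : p • x = m • k) (hpm : ¬(p : ℤ) ∣ m) :
    ∃ w, addOrderOf w = 0 ∧ J = zmultiples w := by
  obtain ⟨u, v, huv⟩ : IsCoprime (p : ℤ) m :=
    (Nat.prime_iff_prime_int.1 hp).coprime_iff_not_dvd.2 hpm
  set w := v • x + u • k
  have hwJ : zmultiples w ≤ J :=
    zmultiples_le_of_mem (J.add_mem (J.zsmul_mem hxJ v) (J.zsmul_mem hkJ u))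
  have hpw : p • w = k := calc
    p • w = p • v • x + p • u • k := ((hxk.zsmul_left v).zsmul_right u).add_nsmul p
    _ = v • p • x + u • p • k := by
      simp only [← natCast_zsmul, zsmul_comm _ (p : ℤ)]
    _ = (u * p + v * m) • k := by
      rw [hpx, ← natCast_zsmul k, ← mul_zsmul, ← mul_zsmul, ← add_zsmul, add_comm]
    _ = k := by rw [huv, one_zsmul]
  have hw : addOrderOf w = 0 := by
    rw [addOrderOf_eq_zero_iff] at hk ⊢
    exact fun h => hk (hpw ▸ h.nsmul)
  have hkw : zmultiples k ≤ zmultiples w :=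
    zmultiples_le_of_mem (hpw ▸ nsmul_mem (mem_zmultiples w) p)
  have hindex : (zmultiples k).relIndex (zmultiples w) = p := by
    conv_lhs => rw [← hpw]
    exact relIndex_zmultiples_nsmul hw p
  have hw_index : (zmultiples w).relIndex J = 1 := by
    have h := relIndex_mul_relIndex _ _ _ hkw hwJ
    rw [hindex, hJ] at h
    exact Nat.eq_of_mul_eq_mul_left hp.pos (h.trans (mul_one p).symm)
  exact ⟨w, hw, le_antisymm (relIndex_eq_one.1 hw_index) hwJ⟩

end Group

theorem exists_chain_of_reflTransGen {α : Type*} {r : α → α → Prop} {a b : α}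
    (h : Relation.ReflTransGen r a b) :
    ∃ (n : ℕ) (c : ℕ → α), c 0 = a ∧ c n = b ∧ ∀ i < n, r (c i) (c (i + 1)) := by
  induction h using Relation.ReflTransGen.head_induction_on with
  | refl => exact ⟨0, fun _ => b, rfl, rfl, fun i hi => absurd hi i.not_lt_zero⟩
  | @head a d h _ ih =>
    obtain ⟨n, c, rfl, hn, hc⟩ := ih
    refine ⟨n + 1, fun i => i.casesOn a c, rfl, hn, fun i hi => ?_⟩
    cases i with
    | zero => exact h
    | succ i => exact hc i (Nat.lt_of_succ_lt_succ hi)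

namespace SkewBrace

variable {B : Type*} [SkewBrace B]

/-- The map `λ_b` as an endomorphism of the additive group. -/
def lamHom (b : B) : B →+ B where
  toFun := lam b
  map_zero' := lam_zero b
  map_add' := lam_add b

theorem lam_nsmul (b : B) (n : ℕ) (x : B) : lam b (n • x) = n • lam b x :=
  map_nsmul (lamHom b) n x

theorem lam_zsmul (b : B) (n : ℤ) (x : B) : lam b (n • x) = n • lam b x :=
  map_zsmul (lamHom b) n x

theorem pow_eq_nsmul_of_lam_self {x : B} (hx : lam x x = x) (n : ℕ) : x ^ n = n • x := by
  induction n with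
  | zero => rw [pow_zero, zero_nsmul, one_eq_zero]
  | succ n ih => rw [pow_succ', ih, mul_eq_add_lam, lam_nsmul, hx, succ_nsmul']

theorem lam_pow_of_lam_eq_zsmul {b x : B} {n : ℤ} (h : lam b x = n • x) (m : ℕ) :
    lam (b ^ m) x = n ^ m • x := by
  induction m with
  | zero => rw [pow_zero, pow_zero, one_zsmul, lam_one]
  | succ m ih => rw [pow_succ, lam_mul, h, lam_zsmul, ih, ← mul_zsmul, ← pow_succ']

theorem lam_pow_of_lam_eq_add {x b f : B} (hb : lam x b = b + f) (hf : lam x f = f) (m : ℕ) :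
    lam (x ^ m) b = b + m • f := by
  induction m with
  | zero => rw [pow_zero, zero_nsmul, add_zero, lam_one]
  | succ m ih => rw [pow_succ', lam_mul, ih, lam_add, hb, lam_nsmul, hf, succ_nsmul', add_assoc]

theorem mem_socle {x : B} : x ∈ socle B ↔ ∀ b, lam x b = b ∧ b + x = x + b := by
  rw [forall_and, ← AddSubgroup.mem_center_iff]
  rfl

theorem mem_zeta {x : B} : x ∈ zeta B ↔ x ∈ socle B ∧ ∀ b, b * x = x * b := by
  rw [← Subgroup.mem_center_iff]
  rfl

variable (B) in
/-- The socle as a subgroup of `(B, +)`. -/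
def socleAddSubgroup : AddSubgroup B where
  carrier := socle B
  zero_mem' := mem_socle.2 fun b => ⟨by rw [← one_eq_zero, lam_one], by rw [add_zero, zero_add]⟩
  add_mem' {x y} hx hy := by
    refine ⟨fun b => ?_, AddSubgroup.add_mem _ hx.2 hy.2⟩
    have hxy : x + y = x * y := by rw [mul_eq_add_lam, hx.1]
    rw [hxy, lam_mul, hy.1, hx.1]
  neg_mem' {x} hx := by
    refine ⟨fun b => ?_, AddSubgroup.neg_mem _ hx.2⟩
    have hker : ∀ c, lam x⁻¹ c = c := fun c => by rw [← hx.1 (lam x⁻¹ c), lam_lam_inv]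
    rw [← hker (-x), ← inv_eq_lam, hker]

theorem lam_eq_self_of_mem_zeta {x : B} (hx : x ∈ zeta B) (b : B) : lam b x = x := by
  obtain ⟨hsoc, hmul⟩ := mem_zeta.1 hx
  obtain ⟨hlam, hadd⟩ := mem_socle.1 hsoc b
  have h : b + lam b x = b + x := by rw [← mul_eq_add_lam, hmul, mul_eq_add_lam, hlam, hadd]
  exact add_left_cancel h

/-- `λ_x` is multiplication by some `n` on the cyclic group `(B, +)`, and `x ^ p = 1` gives
`1 = n ^ p = n` modulo `p`. -/
theorem lam_eq_self_of_natCard_eq_prime {p : ℕ} (hp : p.Prime) (h : Nat.card B = p) (x y : B) :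
    lam x y = y := by
  have := Fact.mk hp
  have := isAddCyclic_of_prime_card h
  obtain ⟨n, hn⟩ := (lamHom x).map_addCyclic
  have hpow : n ^ p • y = y := by
    rw [← lam_pow_of_lam_eq_zsmul (hn y), ← h, pow_card_eq_one', lam_one]
  have hnp : (p : ℤ) ∣ n ^ p - n := by
    rw [← ZMod.intCast_eq_intCast_iff_dvd_sub]
    simp
  have hord : (addOrderOf y : ℤ) ∣ n ^ p - n :=
    (Int.natCast_dvd_natCast.2 (h ▸ addOrderOf_dvd_natCard y)).trans hnp
  rw [addOrderOf_dvd_iff_zsmul_eq_zero, sub_zsmul, hpow, add_neg_eq_zero] at hord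
  exact (hn y).trans hord.symm

namespace BraceIdeal

theorem proj_lam (I : BraceIdeal B) (a b : B) :
    I.proj (lam a b) = lam (I.proj a) (I.proj b) := by
  simp only [lam, map_add, map_neg, proj_mul]

theorem proj_pow (I : BraceIdeal B) (a : B) (n : ℕ) : I.proj (a ^ n) = I.proj a ^ n :=
  map_pow (MonoidHom.mk' I.proj I.proj_mul) a n

theorem proj_eq_zero {I : BraceIdeal B} {a : B} : I.proj a = 0 ↔ a ∈ I :=
  QuotientAddGroup.eq_zero_iff a

theorem neg_add_lam_mem {I : BraceIdeal B} {x : B} (hx : x ∈ I) (b : B) : -b + lam x b ∈ I := by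
  rw [← proj_eq_proj, proj_lam, proj_eq_zero.2 hx, ← one_eq_zero, lam_one]

theorem proj_mem_socle_iff {I : BraceIdeal B} {x : B} :
    I.proj x ∈ socle I.Quot ↔
      ∀ b, I.proj (lam x b) = I.proj b ∧ I.proj (b + x) = I.proj (x + b) := by
  simp only [mem_socle, I.proj_surjective.forall, proj_lam, map_add]

theorem proj_mem_socle (I : BraceIdeal B) {x : B} (hx : x ∈ socle B) : I.proj x ∈ socle I.Quot :=
  proj_mem_socle_iff.2 fun b =>
    (mem_socle.1 hx b).imp (congrArg I.proj) (congrArg I.proj)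

/-- The ideal with a given additive group. Closure under `*` and `⁻¹` is automatic, as
`a * b = a + λ_a(b)` and `a⁻¹ = λ_{a⁻¹}(-a)`. -/
def ofAddSubgroup (S : AddSubgroup B) (hlam : ∀ (b : B) {a : B}, a ∈ S → lam b a ∈ S)
    (hadd : ∀ (b : B) {a : B}, a ∈ S → b + a + -b ∈ S)
    (hmul : ∀ (b : B) {a : B}, a ∈ S → b * a * b⁻¹ ∈ S) : BraceIdeal B where
  toAddSubgroup := S
  mul_mem := fun {a b} ha hb => by rw [mul_eq_add_lam]; exact S.add_mem ha (hlam a hb)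
  inv_mem := fun {a} ha => by rw [inv_eq_lam]; exact hlam _ (S.neg_mem ha)
  lam_mem := hlam
  add_conj_mem := hadd
  mul_conj_mem := hmul

/-- A `λ`-invariant additive subgroup of the socle, as an ideal. -/
def ofSocle (S : AddSubgroup B) (hlam : ∀ (b : B) {x : B}, x ∈ S → lam b x ∈ S)
    (hS : (S : Set B) ⊆ socle B) : BraceIdeal B :=
  ofAddSubgroup S hlam
    (fun b a ha => by rwa [(mem_socle.1 (hS ha) b).2, add_neg_cancel_right])
    (fun b a ha => by
      obtain ⟨hker, hcenter⟩ := mem_socle.1 (hS (hlam b ha)) b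
      have h : b * a = lam b a * b := by
        rw [mul_eq_add_lam b a, mul_eq_add_lam (lam b a) b, hker, hcenter]
      rw [h, mul_inv_cancel_right]
      exact hlam b ha)

/-- The ideal whose additive group is generated by a single element of the socle. -/
def zmultiples (g : B) (hg : g ∈ socle B) (hlam : ∀ b, lam b g ∈ AddSubgroup.zmultiples g) :
    BraceIdeal B :=
  ofSocle (AddSubgroup.zmultiples g)
    (fun b x hx => by
      obtain ⟨n, rfl⟩ := AddSubgroup.mem_zmultiples_iff.1 hx
      rw [lam_zsmul]
      exact AddSubgroup.zsmul_mem _ (hlam b) n)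
    (AddSubgroup.zmultiples_le_of_mem hg : _ ≤ socleAddSubgroup B)

instance : OrderBot (BraceIdeal B) where
  bot := ofSocle ⊥ (fun b x hx => by rw [AddSubgroup.mem_bot.1 hx]; exact lam_zero b)
    fun x hx => by rw [AddSubgroup.mem_bot.1 hx]; exact (socleAddSubgroup B).zero_mem
  bot_le I x hx := by rw [AddSubgroup.mem_bot.1 hx]; exact I.zero_mem

instance : OrderTop (BraceIdeal B) where
  top := ofAddSubgroup ⊤ (fun _ _ _ => trivial) (fun _ _ _ => trivial) (fun _ _ _ => trivial)
  le_top _ _ _ := trivial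

instance : SemilatticeInf (BraceIdeal B) where
  inf I J := ofAddSubgroup (I.toAddSubgroup ⊓ J.toAddSubgroup)
    (fun b _ h => h.imp (I.lam_mem b) (J.lam_mem b))
    (fun b _ h => h.imp (I.add_conj_mem b) (J.add_conj_mem b))
    (fun b _ h => h.imp (I.mul_conj_mem b) (J.mul_conj_mem b))
  inf_le_left _ _ _ h := h.1
  inf_le_right _ _ _ h := h.2
  le_inf _ _ _ hJ hK _ h := ⟨hJ h, hK h⟩

theorem mem_bot {x : B} : x ∈ (⊥ : BraceIdeal B) ↔ x = 0 := Iff.rfl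

/-- The preimage in `B` of an ideal of `B / I`. -/
def comap (I : BraceIdeal B) (J : BraceIdeal I.Quot) : BraceIdeal B :=
  ofAddSubgroup (J.toAddSubgroup.comap I.proj)
    (fun b a ha => by
      rw [AddSubgroup.mem_comap, proj_lam]
      exact J.lam_mem _ ha)
    (fun b a ha => by
      rw [AddSubgroup.mem_comap, map_add, map_add, map_neg]
      exact J.add_conj_mem _ ha)
    (fun b _ ha => J.mul_conj_mem (I.proj b) ha)

theorem mem_comap {I : BraceIdeal B} {J : BraceIdeal I.Quot} {x : B} :
    x ∈ I.comap J ↔ I.proj x ∈ J := Iff.rfl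

theorem comap_bot (I : BraceIdeal B) : I.comap ⊥ = I :=
  SetLike.ext fun _ => proj_eq_zero

theorem proj_comap_eq_proj_comap {I : BraceIdeal B} {J : BraceIdeal I.Quot} {a b : B} :
    (I.comap J).proj a = (I.comap J).proj b ↔ J.proj (I.proj a) = J.proj (I.proj b) := by
  rw [proj_eq_proj, proj_eq_proj, mem_comap, map_add, map_neg]

theorem comap_le_comap {I : BraceIdeal B} {J K : BraceIdeal I.Quot} :
    I.comap J ≤ I.comap K ↔ J ≤ K :=
  AddSubgroup.comap_le_comap_of_surjective I.proj_surjective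

/-- The image of an ideal in the quotient `B / I`. -/
def map (I J : BraceIdeal B) : BraceIdeal I.Quot :=
  ofAddSubgroup (J.factor I)
    (by
      rintro b _ ⟨a, ha, rfl⟩
      obtain ⟨b, rfl⟩ := I.proj_surjective b
      exact ⟨lam b a, J.lam_mem b ha, I.proj_lam b a⟩)
    (by
      rintro b _ ⟨a, ha, rfl⟩
      obtain ⟨b, rfl⟩ := I.proj_surjective b
      exact ⟨b + a + -b, J.add_conj_mem b ha, by simp only [map_add, map_neg]⟩)
    (by
      rintro b _ ⟨a, ha, rfl⟩
      obtain ⟨b, rfl⟩ := I.proj_surjective b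
      exact ⟨b * a * b⁻¹, J.mul_conj_mem b ha, rfl⟩)

theorem ker_proj (I : BraceIdeal B) : I.proj.ker = I.toAddSubgroup :=
  QuotientAddGroup.ker_mk' _

theorem exists_comap_eq {I J : BraceIdeal B} (h : I ≤ J) :
    ∃ J' : BraceIdeal I.Quot, I.comap J' = J :=
  ⟨I.map J, SetLike.ext fun x =>
    SetLike.ext_iff.1 (AddSubgroup.comap_map_eq_self (I.ker_proj.trans_le h)) x⟩

theorem natCard_nsmul_eq_zero (I : BraceIdeal B) {x : B} (hx : x ∈ I) : Nat.card I • x = 0 :=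
  congrArg Subtype.val (card_nsmul_eq_zero' (x := (⟨x, hx⟩ : I)))

theorem pow_natCard_eq_one (I : BraceIdeal B) {x : B} (hx : x ∈ I) : x ^ Nat.card I = 1 :=
  congrArg Subtype.val (pow_card_eq_one' (x := (⟨x, hx⟩ : I)))

/-- `J / I` is infinite cyclic and contained in `Soc(B / I)`; the first kind of factor of a
supersoluble skew brace. It is phrased with representatives in `B`. -/
structure CyclicStep (I J : BraceIdeal B) : Prop where
  le : I ≤ J
  exists_generator : ∃ g ∈ J, (∀ n : ℤ, n • g ∈ I → n = 0) ∧
    ∀ x ∈ J, ∃ n : ℤ, I.proj (n • g) = I.proj x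
  proj_mem_socle : ∀ x ∈ J, I.proj x ∈ socle I.Quot

/-- `J / I` has order `p`. -/
structure OrderStep (p : ℕ) (I J : BraceIdeal B) : Prop where
  le : I ≤ J
  relIndex_eq : I.toAddSubgroup.relIndex J.toAddSubgroup = p

theorem relIndex_eq_natCard_factor (I J : BraceIdeal B) :
    I.toAddSubgroup.relIndex J.toAddSubgroup = Nat.card (J.factor I) := by
  rw [← ker_proj, AddSubgroup.relIndex_ker]
  rfl

theorem cyclicStep_iff {I J : BraceIdeal B} :
    CyclicStep I J ↔ I ≤ J ∧ (∃ g ∈ J, (∀ n : ℤ, n • g ∈ I → n = 0) ∧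
      ∀ x ∈ J, ∃ n : ℤ, I.proj (n • g) = I.proj x) ∧ ∀ x ∈ J, I.proj x ∈ socle I.Quot :=
  ⟨fun ⟨hle, hgen, hsoc⟩ => ⟨hle, hgen, hsoc⟩, fun ⟨hle, hgen, hsoc⟩ => ⟨hle, hgen, hsoc⟩⟩

theorem cyclicStep_comap {I : BraceIdeal B} {J K : BraceIdeal I.Quot} :
    CyclicStep (I.comap J) (I.comap K) ↔ CyclicStep J K := by
  simp only [cyclicStep_iff, comap_le_comap, mem_comap, proj_mem_socle_iff,
    proj_comap_eq_proj_comap]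
  simp only [I.proj_surjective.forall, I.proj_surjective.exists, proj_lam, map_add, map_zsmul]

theorem cyclicStep_comap_right {I : BraceIdeal B} {K : BraceIdeal I.Quot} :
    CyclicStep I (I.comap K) ↔ CyclicStep ⊥ K := by
  rw [← cyclicStep_comap, comap_bot]

theorem proj_bot_eq_proj_bot {a b : B} :
    (⊥ : BraceIdeal B).proj a = (⊥ : BraceIdeal B).proj b ↔ a = b := by
  rw [proj_eq_proj, mem_bot, neg_add_eq_zero]

theorem cyclicStep_bot {J : BraceIdeal B} :
    CyclicStep ⊥ J ↔ (∃ g, addOrderOf g = 0 ∧ J.toAddSubgroup = AddSubgroup.zmultiples g) ∧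
      (J : Set B) ⊆ socle B := by
  simp only [cyclicStep_iff, bot_le, true_and, mem_bot, proj_bot_eq_proj_bot, proj_mem_socle_iff,
    ← mem_socle, addOrderOf_eq_zero_iff_forall_zsmul]
  refine and_congr (exists_congr fun g => ⟨?_, ?_⟩) Iff.rfl
  · rintro ⟨hgJ, hg, hgen⟩
    exact ⟨hg, le_antisymm (fun x hx => AddSubgroup.mem_zmultiples_iff.2 (hgen x hx))
      (AddSubgroup.zmultiples_le_of_mem hgJ)⟩
  · rintro ⟨hg, hJ⟩
    have hmem : ∀ x, x ∈ J ↔ x ∈ AddSubgroup.zmultiples g := SetLike.ext_iff.1 hJ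
    exact ⟨(hmem g).2 (AddSubgroup.mem_zmultiples g), hg,
      fun x hx => AddSubgroup.mem_zmultiples_iff.1 ((hmem x).1 hx)⟩

theorem orderStep_comap {p : ℕ} {I : BraceIdeal B} {J K : BraceIdeal I.Quot} :
    OrderStep p (I.comap J) (I.comap K) ↔ OrderStep p J K := by
  have h : (I.comap J).toAddSubgroup.relIndex (I.comap K).toAddSubgroup =
      J.toAddSubgroup.relIndex K.toAddSubgroup :=
    (AddSubgroup.relIndex_comap _ _ _).trans (congrArg _
      (AddSubgroup.map_comap_eq_self_of_surjective I.proj_surjective _))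
  exact ⟨fun ⟨hle, hp⟩ => ⟨comap_le_comap.1 hle, h ▸ hp⟩,
    fun ⟨hle, hp⟩ => ⟨comap_le_comap.2 hle, h ▸ hp⟩⟩

theorem orderStep_comap_right {p : ℕ} {I : BraceIdeal B} {K : BraceIdeal I.Quot} :
    OrderStep p I (I.comap K) ↔ OrderStep p ⊥ K := by
  rw [← orderStep_comap, comap_bot]

theorem orderStep_bot {p : ℕ} {J : BraceIdeal B} : OrderStep p ⊥ J ↔ Nat.card J = p := by
  have h : (⊥ : BraceIdeal B).toAddSubgroup.relIndex J.toAddSubgroup = Nat.card J :=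
    AddSubgroup.relIndex_bot_left _
  exact ⟨fun hJ => h ▸ hJ.relIndex_eq, fun hJ => ⟨bot_le, h ▸ hJ⟩⟩

theorem OrderStep.nsmul_mem {p : ℕ} {I J : BraceIdeal B} (h : OrderStep p I J) {x : B}
    (hx : x ∈ J) : p • x ∈ I := by
  obtain ⟨J, rfl⟩ := exists_comap_eq h.le
  rw [← proj_eq_zero, map_nsmul, ← orderStep_bot.1 (orderStep_comap_right.1 h)]
  exact J.natCard_nsmul_eq_zero hx

theorem OrderStep.pow_mem {p : ℕ} {I J : BraceIdeal B} (h : OrderStep p I J) {x : B}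
    (hx : x ∈ J) : x ^ p ∈ I := by
  obtain ⟨J, rfl⟩ := exists_comap_eq h.le
  rw [← proj_eq_zero, proj_pow, ← orderStep_bot.1 (orderStep_comap_right.1 h), ← one_eq_zero]
  exact J.pow_natCard_eq_one hx

theorem OrderStep.proj_lam_eq {p : ℕ} (hp : p.Prime) {I J : BraceIdeal B} (h : OrderStep p I J)
    {x y : B} (hx : x ∈ J) (hy : y ∈ J) : I.proj (lam x y) = I.proj y := by
  obtain ⟨J, rfl⟩ := exists_comap_eq h.le
  have hJ : Nat.card J = p := orderStep_bot.1 (orderStep_comap_right.1 h)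
  rw [proj_lam]
  exact congrArg Subtype.val (lam_eq_self_of_natCard_eq_prime hp hJ ⟨_, hx⟩ ⟨_, hy⟩)

theorem apply_eq_self_of_natCard_eq_two {E : BraceIdeal B} (hE : Nat.card E = 2) {f : B → B}
    (hf : Function.Injective f) (hf0 : f 0 = 0) (hfE : ∀ x ∈ E, f x ∈ E) {x : B} (hx : x ∈ E) :
    f x = x := by
  rcases eq_or_ne x 0 with rfl | hx0
  · exact hf0
  obtain ⟨z, -, hz⟩ := (Nat.card_eq_two_iff' (0 : E)).1 hE
  have hxz : (⟨x, hx⟩ : E) = z := hz _ fun h => hx0 (congrArg Subtype.val h)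
  have hfz : (⟨f x, hfE x hx⟩ : E) = z :=
    hz _ fun h => hx0 (hf ((congrArg Subtype.val h).trans hf0.symm))
  exact congrArg Subtype.val (hfz.trans hxz.symm)

theorem subset_zeta_of_natCard_eq_two {E : BraceIdeal B} (hE : Nat.card E = 2) :
    (E : Set B) ⊆ zeta B := by
  intro x hx
  have hlam : ∀ b, lam b x = x := fun b =>
    apply_eq_self_of_natCard_eq_two hE (Function.LeftInverse.injective (g := lam b⁻¹) fun y => by
      rw [← lam_mul, inv_mul_cancel, lam_one]) (lam_zero b) (fun _ => E.lam_mem b) hx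
  have hadd : ∀ b, b + x = x + b := fun b =>
    add_neg_eq_iff_eq_add.1 (apply_eq_self_of_natCard_eq_two hE (f := fun y => b + y + -b)
      ((add_left_injective _).comp (add_right_injective b)) (by rw [add_zero, add_neg_cancel])
      (fun _ => E.add_conj_mem b) hx)
  have hmul : ∀ b, b * x = x * b := fun b =>
    mul_inv_eq_iff_eq_mul.1 (apply_eq_self_of_natCard_eq_two hE (f := fun y => b * y * b⁻¹)
      ((mul_left_injective _).comp (mul_right_injective b))
      (by rw [mul_zero_eq, mul_inv_cancel, one_eq_zero]) (fun _ => E.mul_conj_mem b) hx)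
  have hker : ∀ b, lam x b = b := fun b => by
    have h : x + lam x b = x + b := by
      rw [← mul_eq_add_lam, ← hmul, mul_eq_add_lam, hlam, hadd]
    exact add_left_cancel h
  exact mem_zeta.2 ⟨mem_socle.2 fun b => ⟨hker b, hadd b⟩, hmul⟩

/-! ### Moving factors of odd prime order down a chain -/

/-- `J` is the internal direct sum of the ideals `K` and `T`. -/
structure IsDirectSum (K T J : BraceIdeal B) : Prop where
  disjoint : Disjoint K.toAddSubgroup T.toAddSubgroup
  sup_eq : K.toAddSubgroup ⊔ T.toAddSubgroup = J.toAddSubgroup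

namespace IsDirectSum

variable {K T J : BraceIdeal B} {p : ℕ}

protected theorem symm (h : IsDirectSum K T J) : IsDirectSum T K J :=
  ⟨h.disjoint.symm, (sup_comm _ _).trans h.sup_eq⟩

theorem left_le (h : IsDirectSum K T J) : K ≤ J :=
  (le_sup_left.trans_eq h.sup_eq : K.toAddSubgroup ≤ J.toAddSubgroup)

theorem exists_add_eq (h : IsDirectSum K T J) {x : B} (hx : x ∈ J) :
    ∃ k ∈ K, ∃ t ∈ T, k + t = x :=
  AddSubgroup.mem_sup_of_normal_right.1 (h.sup_eq.ge hx)

theorem orderStep_iff (h : IsDirectSum K T J) : OrderStep p T J ↔ OrderStep p ⊥ K := by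
  have hindex : T.toAddSubgroup.relIndex J.toAddSubgroup = Nat.card K := by
    rw [← h.sup_eq, AddSubgroup.relIndex_sup_right, ← AddSubgroup.inf_relIndex_right,
      h.disjoint.symm.eq_bot]
    exact AddSubgroup.relIndex_bot_left _
  rw [orderStep_bot, ← hindex]
  exact ⟨OrderStep.relIndex_eq, fun hp => ⟨h.symm.left_le, hp⟩⟩

theorem cyclicStep (h : IsDirectSum K T J) (hK : CyclicStep ⊥ K) : CyclicStep T J := by
  obtain ⟨⟨g, hg, hKg⟩, hsoc⟩ := cyclicStep_bot.1 hK
  have hmem : ∀ k, k ∈ K ↔ k ∈ AddSubgroup.zmultiples g := SetLike.ext_iff.1 hKg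
  have hgK : g ∈ K := (hmem g).2 (AddSubgroup.mem_zmultiples g)
  have hproj : ∀ k, ∀ t ∈ T, T.proj (k + t) = T.proj k := fun k t ht => by
    rw [map_add, proj_eq_zero.2 ht, add_zero]
  refine ⟨h.symm.left_le, ⟨g, h.left_le hgK, fun n hn => ?_, fun x hx => ?_⟩, fun x hx => ?_⟩
  · exact addOrderOf_eq_zero_iff_forall_zsmul.1 hg n
      (AddSubgroup.disjoint_def.1 h.disjoint (K.toAddSubgroup.zsmul_mem hgK n) hn)
  all_goals obtain ⟨k, hk, t, ht, rfl⟩ := h.exists_add_eq hx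
  · obtain ⟨n, rfl⟩ := AddSubgroup.mem_zmultiples_iff.1 ((hmem k).1 hk)
    exact ⟨n, (hproj _ t ht).symm⟩
  · rw [hproj k t ht]
    exact T.proj_mem_socle (hsoc hk)

end IsDirectSum

/-- The skew brace `J` is abelian: its two operations coincide and are commutative. -/
structure IsAbelian (J : BraceIdeal B) : Prop where
  lam_eq : ∀ x ∈ J, ∀ y ∈ J, lam x y = y
  add_comm : ∀ x ∈ J, ∀ y ∈ J, x + y = y + x

namespace IsAbelian

variable {K J : BraceIdeal B} {p : ℕ}

theorem pow_eq_nsmul (hJ : IsAbelian J) {x : B} (hx : x ∈ J) (n : ℕ) : x ^ n = n • x :=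
  pow_eq_nsmul_of_lam_self (hJ.lam_eq x hx x hx) n

theorem eq_of_nsmul_eq (hJ : IsAbelian J) (hinj : ∀ x ∈ J, p • x = 0 → x = 0) {x y : B}
    (hx : x ∈ J) (hy : y ∈ J) (h : p • x = p • y) : x = y := by
  have hcomm : AddCommute x (-y) := hJ.add_comm x hx (-y) (J.neg_mem hy)
  refine add_neg_eq_zero.1 (hinj _ (J.add_mem hx (J.neg_mem hy)) ?_)
  rw [hcomm.add_nsmul, neg_nsmul, h, add_neg_cancel]

theorem subset_socle (hJ : IsAbelian J) (hinj : ∀ x ∈ J, p • x = 0 → x = 0)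
    (hsoc : ∀ x ∈ J, p • x ∈ socle B) : (J : Set B) ⊆ socle B := by
  intro x hx
  refine mem_socle.2 fun b => ⟨?_, ?_⟩
  · set f := -b + lam x b
    have hf : f ∈ J := neg_add_lam_mem hx b
    have hb : lam x b = b + f := (add_neg_cancel_left b _).symm
    have hpf : b + p • f = b + 0 := by
      rw [← lam_pow_of_lam_eq_add hb (hJ.lam_eq x hx f hf), hJ.pow_eq_nsmul hx,
        (mem_socle.1 (hsoc x hx) b).1, add_zero]
    rw [hb, hinj f hf (add_left_cancel hpf), add_zero]
  · have hconj : p • (b + x + -b) = p • x := by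
      rw [addConj_nsmul, (mem_socle.1 (hsoc x hx) b).2, add_neg_cancel_right]
    exact add_neg_eq_iff_eq_add.1 (hJ.eq_of_nsmul_eq hinj (J.add_conj_mem b hx) hx hconj)

/-- The elements of an abelian ideal that are annihilated by `n`. -/
def torsion (hJ : IsAbelian J) (n : ℕ) : BraceIdeal B :=
  ofAddSubgroup
    { carrier := {x | x ∈ J ∧ n • x = 0}
      zero_mem' := ⟨J.zero_mem, nsmul_zero n⟩
      add_mem' := fun {x y} ⟨hx, hnx⟩ ⟨hy, hny⟩ =>
        ⟨J.add_mem hx hy, by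
          rw [AddCommute.add_nsmul (hJ.add_comm x hx y hy), hnx, hny, add_zero]⟩
      neg_mem' := fun ⟨hx, hnx⟩ => ⟨J.neg_mem hx, by rw [neg_nsmul, hnx, neg_zero]⟩ }
    (fun b _ ⟨hx, hnx⟩ => ⟨J.lam_mem b hx, by rw [← lam_nsmul, hnx, lam_zero]⟩)
    (fun b _ ⟨hx, hnx⟩ =>
      ⟨J.add_conj_mem b hx, by rw [addConj_nsmul, hnx, add_zero, add_neg_cancel]⟩)
    (fun b x ⟨hx, hnx⟩ => ⟨J.mul_conj_mem b hx, by
      rw [← hJ.pow_eq_nsmul (J.mul_conj_mem b hx), conj_pow, hJ.pow_eq_nsmul hx, hnx,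
        mul_zero_eq, mul_inv_cancel, one_eq_zero]⟩)

theorem isDirectSum_torsion (hJ : IsAbelian J) (hKJ : K ≤ J)
    (htors : ∀ k ∈ K, p • k = 0 → k = 0) (hdiv : ∀ x ∈ J, ∃ k ∈ K, p • x = p • k) :
    IsDirectSum K (hJ.torsion p) J where
  disjoint := AddSubgroup.disjoint_def.2 fun hk ht => htors _ hk ht.2
  sup_eq := by
    refine le_antisymm (sup_le hKJ fun _ ht => ht.1) fun x hx => ?_
    obtain ⟨k, hk, hpk⟩ := hdiv x hx
    have hkJ : -k ∈ J := J.neg_mem (hKJ hk)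
    have ht : -k + x ∈ hJ.torsion p := ⟨J.add_mem hkJ hx, by
      rw [AddCommute.add_nsmul (hJ.add_comm _ hkJ x hx), neg_nsmul, hpk, neg_add_cancel]⟩
    exact AddSubgroup.mem_sup_of_normal_right.2 ⟨k, hk, _, ht, add_neg_cancel_left k x⟩

end IsAbelian

/-- The elements of `(B, *)` acting trivially on `J / I` through `λ`. -/
def lamFixer (I J : BraceIdeal B) : Subgroup B where
  carrier := {b | ∀ x ∈ J, I.proj (lam b x) = I.proj x}
  mul_mem' {a b} ha hb x hx := by rw [lam_mul, ha _ (J.lam_mem b hx), hb x hx]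
  one_mem' x _ := by rw [lam_one]
  inv_mem' {b} hb x hx := by rw [← hb _ (J.lam_mem b⁻¹ hx), lam_lam_inv]

theorem lam_mul_self_of_addOrderOf_eq_zero {J : BraceIdeal B} {g : B} (hg : addOrderOf g = 0)
    (hJ : J.toAddSubgroup = AddSubgroup.zmultiples g) (b : B) {x : B} (hx : x ∈ J) :
    lam (b * b) x = x := by
  have hmem : ∀ x, x ∈ J ↔ ∃ n : ℤ, n • g = x := fun x =>
    (SetLike.ext_iff.1 hJ x).trans AddSubgroup.mem_zmultiples_iff
  have hlam : ∀ c, ∃ n : ℤ, n • g = lam c g := fun c =>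
    (hmem _).1 (J.lam_mem c ((hmem g).2 ⟨1, one_zsmul g⟩))
  obtain ⟨n, hn⟩ := hlam b
  obtain ⟨m, hm⟩ := hlam b⁻¹
  have hmn : (m * n - 1) • g = 0 := by
    rw [sub_zsmul, mul_zsmul, hn, ← lam_zsmul, hm, lam_lam_inv, one_zsmul, add_neg_cancel]
  have hunit : n * n = 1 := Int.isUnit_mul_self (IsUnit.of_mul_eq_one_right m
    (sub_eq_zero.1 (addOrderOf_eq_zero_iff_forall_zsmul.1 hg _ hmn)))
  have hgg : lam (b * b) g = g := by
    rw [lam_mul, ← hn, lam_zsmul, ← hn, ← mul_zsmul, hunit, one_zsmul]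
  obtain ⟨k, rfl⟩ := (hmem x).1 hx
  rw [lam_zsmul, hgg]

theorem CyclicStep.mul_self_mem_lamFixer {I J : BraceIdeal B} (h : CyclicStep I J) (b : B) :
    b * b ∈ lamFixer I J := by
  obtain ⟨J, rfl⟩ := exists_comap_eq h.le
  obtain ⟨⟨g, hg, hJ⟩, -⟩ := cyclicStep_bot.1 (cyclicStep_comap_right.1 h)
  intro x hx
  rw [proj_lam, proj_mul]
  exact lam_mul_self_of_addOrderOf_eq_zero hg hJ (I.proj b) hx

namespace OrderStep

variable {p : ℕ} {K J : BraceIdeal B}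

theorem add_comm (h : OrderStep p K J) (hp : p.Prime) (hK : (K : Set B) ⊆ socle B) {x y : B}
    (hx : x ∈ J) (hy : y ∈ J) : x + y = y + x := by
  have := Fact.mk hp
  have : IsAddCyclic (J.toAddSubgroup.map K.proj) := isAddCyclic_of_prime_card
    ((relIndex_eq_natCard_factor K J).symm.trans h.relIndex_eq)
  have := (K.proj.addSubgroupMap J.toAddSubgroup).isAddCommutative_of_isAddCyclic_of_ker_le_center
    fun k hk => AddSubgroup.mem_center_iff.2 fun z => Subtype.ext
      ((mem_socle.1 (hK (proj_eq_zero.1 (congrArg Subtype.val hk))) z).2)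
  exact congrArg Subtype.val (add_comm' (⟨x, hx⟩ : J.toAddSubgroup) ⟨y, hy⟩)

/-- As `x ^ p` and all squares act trivially on `K`, so does `x`; it also acts trivially on `J / K`,
so `λ_x(y) = y + f` with `f ∈ K`, and applying this `p` times gives `p • f = 0`. -/
theorem lam_eq_self (h : OrderStep p K J) (hp : p.Prime) (hodd : Odd p)
    (hK : (K : Set B) ⊆ socle B) (hsq : ∀ b, b * b ∈ lamFixer ⊥ K)
    (htors : ∀ k ∈ K, p • k = 0 → k = 0) {x y : B} (hx : x ∈ J) (hy : y ∈ J) : lam x y = y := by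
  have hxp : ∀ b, lam (x ^ p) b = b := fun b => (mem_socle.1 (hK (h.pow_mem hx)) b).1
  have hxK : x ∈ lamFixer ⊥ K :=
    mem_of_pow_mem_of_odd hsq hodd fun k _ => congrArg _ (hxp k)
  set f := -y + lam x y
  have hf : f ∈ K := K.proj_eq_proj.1 (h.proj_lam_eq hp hx hy).symm
  have hy_add : lam x y = y + f := (add_neg_cancel_left y _).symm
  have hpf : y + p • f = y + 0 := by
    rw [← lam_pow_of_lam_eq_add hy_add (proj_bot_eq_proj_bot.1 (hxK f hf)), hxp, add_zero]
  rw [hy_add, htors f hf (add_left_cancel hpf), add_zero]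

theorem isAbelian (h : OrderStep p K J) (hp : p.Prime) (hodd : Odd p)
    (hK : (K : Set B) ⊆ socle B) (hsq : ∀ b, b * b ∈ lamFixer ⊥ K)
    (htors : ∀ k ∈ K, p • k = 0 → k = 0) : IsAbelian J :=
  ⟨fun _ hx _ hy => h.lam_eq_self hp hodd hK hsq htors hx hy,
    fun _ hx _ hy => h.add_comm hp hK hx hy⟩

theorem exists_isDirectSum_of_natCard_eq_two (h : OrderStep p K J) (hp : p.Prime) (hodd : Odd p)
    (hK : Nat.card K = 2) : ∃ T, IsDirectSum K T J := by
  have hzeta := subset_zeta_of_natCard_eq_two hK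
  have hpk : ∀ k ∈ K, p • k = k := fun k hk => by
    obtain ⟨m, rfl⟩ := hodd
    rw [succ_nsmul, mul_comm, mul_nsmul', ← hK, K.natCard_nsmul_eq_zero hk, nsmul_zero, zero_add]
  have htors : ∀ k ∈ K, p • k = 0 → k = 0 := fun k hk => (hpk k hk).symm.trans
  have hJ : IsAbelian J := h.isAbelian hp hodd (fun k hk => (hzeta hk).1)
    (fun b k hk => congrArg _ (lam_eq_self_of_mem_zeta (hzeta hk) _)) htors
  exact ⟨_, hJ.isDirectSum_torsion h.le htors fun x hx =>
    ⟨p • x, h.nsmul_mem hx, (hpk _ (h.nsmul_mem hx)).symm⟩⟩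

/-- Either `J` splits over `K`, or it is a non-split abelian extension of `ℤ` by a group of order
`p`, hence infinite cyclic. -/
theorem cyclicStep_or_exists_isDirectSum (h : OrderStep p K J) (hp : p.Prime) (hodd : Odd p)
    (hK : CyclicStep ⊥ K) : CyclicStep ⊥ J ∨ ∃ T, IsDirectSum K T J := by
  obtain ⟨⟨g, hg, hKg⟩, hsoc⟩ := cyclicStep_bot.1 hK
  have hmem : ∀ k, k ∈ K ↔ ∃ n : ℤ, n • g = k := fun k =>
    (SetLike.ext_iff.1 hKg k).trans AddSubgroup.mem_zmultiples_iff
  have htors : ∀ k ∈ K, p • k = 0 → k = 0 := fun k hk =>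
    eq_zero_of_nsmul_eq_zero_of_mem_zmultiples hg hp.ne_zero ((SetLike.ext_iff.1 hKg k).1 hk)
  have hJ : IsAbelian J := h.isAbelian hp hodd hsoc hK.mul_self_mem_lamFixer htors
  by_cases hdiv : ∀ x ∈ J, ∃ k ∈ K, p • x = p • k
  · exact .inr ⟨_, hJ.isDirectSum_torsion h.le htors hdiv⟩
  push Not at hdiv
  obtain ⟨x, hx, hpx⟩ := hdiv
  obtain ⟨m, hm⟩ := (hmem _).1 (h.nsmul_mem hx)
  have hgJ : g ∈ J := h.le ((hmem g).2 ⟨1, one_zsmul g⟩)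
  have hpm : ¬(p : ℤ) ∣ m := by
    rintro ⟨c, rfl⟩
    exact hpx _ ((hmem _).2 ⟨c, rfl⟩) (by rw [← hm, mul_zsmul, natCast_zsmul])
  obtain ⟨w, hw, hJw⟩ := exists_zmultiples_eq_of_relIndex_eq_prime hp hg
    (hKg ▸ h.relIndex_eq) hgJ hx (hJ.add_comm x hx g hgJ) hm.symm hpm
  refine .inl (cyclicStep_bot.2 ⟨⟨w, hw, hJw⟩, hJ.subset_socle (fun y hy => ?_) fun y hy =>
    hsoc (h.nsmul_mem hy)⟩)
  exact eq_zero_of_nsmul_eq_zero_of_mem_zmultiples hw hp.ne_zero ((SetLike.ext_iff.1 hJw y).1 hy)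

end OrderStep

/-- `J / I` has order two, or it is infinite cyclic and contained in `Soc(B / I)`. -/
def CyclicOrTwoStep (I J : BraceIdeal B) : Prop := CyclicStep I J ∨ OrderStep 2 I J

theorem CyclicOrTwoStep.le {I J : BraceIdeal B} (h : CyclicOrTwoStep I J) : I ≤ J :=
  h.elim CyclicStep.le OrderStep.le

theorem OrderStep.swap {p : ℕ} {I K J : BraceIdeal B} (h : OrderStep p K J) (hp : p.Prime)
    (hodd : Odd p) (hK : CyclicOrTwoStep I K) :
    CyclicStep I J ∨ ∃ T, OrderStep p I T ∧ CyclicOrTwoStep T J := by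
  obtain ⟨J, rfl⟩ := exists_comap_eq (hK.le.trans h.le)
  obtain ⟨K, rfl⟩ := exists_comap_eq hK.le
  rw [orderStep_comap] at h
  simp only [CyclicOrTwoStep, cyclicStep_comap_right, orderStep_comap_right] at hK ⊢
  have hsplit : CyclicStep ⊥ J ∨ ∃ T, IsDirectSum K T J := by
    rcases hK with hK | hK
    · exact h.cyclicStep_or_exists_isDirectSum hp hodd hK
    · exact .inr (h.exists_isDirectSum_of_natCard_eq_two hp hodd (orderStep_bot.1 hK))
  exact hsplit.imp_right fun ⟨T, hT⟩ =>
    ⟨I.comap T, orderStep_comap_right.2 (hT.symm.orderStep_iff.1 h),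
      hK.imp (fun hK => cyclicStep_comap.2 (hT.cyclicStep hK))
        fun hK => orderStep_comap.2 (hT.orderStep_iff.2 hK)⟩

/-- Swapping moves the factor of order `p` down the chain, until it is absorbed by an infinite
cyclic factor or reaches the bottom, where its elements would be `p`-torsion. -/
theorem OrderStep.reflTransGen_cyclicOrTwoStep {p : ℕ} {I J : BraceIdeal B}
    (h : OrderStep p I J) (hp : p.Prime) (hodd : Odd p) (htors : ∀ x : B, p • x = 0 → x = 0)
    (hI : Relation.ReflTransGen CyclicOrTwoStep ⊥ I) :
    Relation.ReflTransGen CyclicOrTwoStep ⊥ J := by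
  induction hI generalizing J with
  | refl =>
    have hJ : J = ⊥ := eq_bot_iff.2 fun x hx => htors x (h.nsmul_mem hx)
    rw [hJ]
  | tail hI hIK ih =>
    rcases h.swap hp hodd hIK with hJ | ⟨T, hT, hTJ⟩
    · exact hI.tail (.inl hJ)
    · exact (ih hT).tail hTJ

/-! ### Moving infinite cyclic factors down a chain -/

theorem nsmul_eq_nsmul_of_proj_eq {E : BraceIdeal B} {n : ℕ} (hE : (E : Set B) ⊆ zeta B)
    (hn : ∀ e ∈ E, n • e = 0) {x y : B} (h : E.proj x = E.proj y) : n • x = n • y := by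
  set e := -x + y
  have he : e ∈ E := E.proj_eq_proj.1 h
  have hcomm : AddCommute x e := (mem_socle.1 (hE he).1 x).2
  rw [← add_neg_cancel_left x y, hcomm.add_nsmul, hn e he, add_zero]

theorem nsmul_mem_socle {E : BraceIdeal B} {n : ℕ} (hE : (E : Set B) ⊆ zeta B)
    (hn : ∀ e ∈ E, n • e = 0) {y : B} (hy : E.proj y ∈ socle E.Quot) : n • y ∈ socle B := by
  have hy' := proj_mem_socle_iff.1 hy
  refine mem_socle.2 fun b => ⟨?_, ?_⟩
  · have hpow : E.proj (n • y) = E.proj (y ^ n) := by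
      rw [proj_pow, map_nsmul, pow_eq_nsmul_of_lam_self ((mem_socle.1 hy _).1)]
    obtain ⟨hc, -⟩ := mem_zeta.1 (hE (E.proj_eq_proj_mul.1 hpow))
    set f := -b + lam y b
    have hf : f ∈ E := E.proj_eq_proj.1 (hy' b).1.symm
    have hb : lam y b = b + f := (add_neg_cancel_left b _).symm
    calc lam (n • y) b = lam (n • y) (lam ((n • y)⁻¹ * y ^ n) b) := by
          rw [(mem_socle.1 hc b).1]
      _ = lam (y ^ n) b := by rw [← lam_mul, mul_inv_cancel_left]
      _ = b := by
        rw [lam_pow_of_lam_eq_add hb (lam_eq_self_of_mem_zeta (hE hf) y), hn f hf, add_zero]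
  · have hconj : E.proj (b + y + -b) = E.proj y := by
      rw [map_add, (hy' b).2, ← map_add, add_neg_cancel_right]
    rw [← add_neg_eq_iff_eq_add, ← addConj_nsmul, nsmul_eq_nsmul_of_proj_eq hE hn hconj]

theorem cyclicStep_zmultiples {g : B} (h0 : addOrderOf g = 0) (hg : g ∈ socle B)
    (hlam : ∀ b, lam b g ∈ AddSubgroup.zmultiples g) : CyclicStep ⊥ (zmultiples g hg hlam) :=
  cyclicStep_bot.2 ⟨⟨g, h0, rfl⟩, (AddSubgroup.zmultiples_le_of_mem hg : _ ≤ socleAddSubgroup B)⟩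

namespace CyclicStep

theorem exists_orderStep_two {I J : BraceIdeal B} (h : CyclicStep I J) :
    ∃ M, CyclicStep I M ∧ OrderStep 2 M J ∧ ∀ x ∈ M, ∃ y ∈ J, I.proj x = I.proj (2 • y) := by
  obtain ⟨J, rfl⟩ := exists_comap_eq h.le
  obtain ⟨⟨g, hg, hJ⟩, hsoc⟩ := cyclicStep_bot.1 (cyclicStep_comap_right.1 h)
  have hmem : ∀ x, x ∈ J ↔ ∃ n : ℤ, n • g = x := fun x =>
    (SetLike.ext_iff.1 hJ x).trans AddSubgroup.mem_zmultiples_iff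
  have hgJ : g ∈ J := (hmem g).2 ⟨1, one_zsmul g⟩
  have h2J : 2 • g ∈ J := J.nsmul_mem hgJ 2
  have hlam : ∀ b, lam b (2 • g) ∈ AddSubgroup.zmultiples (2 • g) := fun b => by
    obtain ⟨n, hn⟩ := (hmem _).1 (J.lam_mem b hgJ)
    rw [lam_nsmul, ← hn, ← zsmul_nsmul_comm]
    exact AddSubgroup.zsmul_mem_zmultiples _ n
  have h2 : addOrderOf (2 • g) = 0 := addOrderOf_nsmul_eq_zero_of_ne_zero hg two_ne_zero
  refine ⟨I.comap (zmultiples _ (hsoc h2J) hlam),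
    cyclicStep_comap_right.2 (cyclicStep_zmultiples h2 _ _), orderStep_comap.2 ⟨?_, ?_⟩, ?_⟩
  · exact (AddSubgroup.zmultiples_le_of_mem h2J : _ ≤ J.toAddSubgroup)
  · rw [hJ]
    exact relIndex_zmultiples_nsmul hg 2
  · intro x hx
    obtain ⟨n, hn⟩ := AddSubgroup.mem_zmultiples_iff.1 hx
    obtain ⟨y, hy⟩ := I.proj_surjective (n • g)
    refine ⟨y, (hmem _).2 ⟨n, hy.symm⟩, ?_⟩
    rw [map_nsmul, hy, ← zsmul_nsmul_comm, hn]

/-- If `E` has order two, then doubling kills `E`, so the doubles of `J` form an infinite cyclic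
ideal meeting `E` trivially. -/
theorem exists_isDirectSum_of_natCard_eq_two {E J : BraceIdeal B} (hE : Nat.card E = 2)
    (h : CyclicStep E J) : ∃ M M', CyclicStep ⊥ M ∧ IsDirectSum M E M' ∧ OrderStep 2 M' J := by
  obtain ⟨g, hgJ, hginj, hgen⟩ := h.exists_generator
  have hEtwo : ∀ e ∈ E, 2 • e = 0 := fun e he => hE ▸ E.natCard_nsmul_eq_zero he
  have hzeta := subset_zeta_of_natCard_eq_two hE
  have htwo : ∀ y ∈ J, 2 • y ∈ AddSubgroup.zmultiples (2 • g) := fun y hy => by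
    obtain ⟨n, hn⟩ := hgen y hy
    rw [nsmul_eq_nsmul_of_proj_eq hzeta hEtwo hn.symm, ← zsmul_nsmul_comm]
    exact AddSubgroup.zsmul_mem_zmultiples _ n
  have hg : addOrderOf g = 0 := addOrderOf_eq_zero_iff_forall_zsmul.2 fun n hn =>
    hginj n (hn ▸ E.zero_mem)
  obtain ⟨M', ⟨hEM', -, -⟩, hM'J, hM'⟩ := h.exists_orderStep_two
  refine ⟨zmultiples (2 • g) (nsmul_mem_socle hzeta hEtwo (h.proj_mem_socle g hgJ)) fun b => by
      rw [lam_nsmul]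
      exact htwo _ (J.lam_mem b hgJ), M',
    cyclicStep_zmultiples (addOrderOf_nsmul_eq_zero_of_ne_zero hg two_ne_zero) _ _, ⟨?_, ?_⟩, hM'J⟩
  · refine AddSubgroup.disjoint_def.2 fun {x} hx hxE => ?_
    obtain ⟨n, rfl⟩ := AddSubgroup.mem_zmultiples_iff.1 hx
    rw [← natCast_zsmul, ← mul_zsmul] at hxE
    have hn : n = 0 := (mul_eq_zero_iff_right two_ne_zero).1 (hginj _ hxE)
    rw [hn, zero_zsmul]
  · refine le_antisymm (sup_le (AddSubgroup.zmultiples_le_of_mem (hM'J.nsmul_mem hgJ)) hEM')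
      fun x hx => ?_
    obtain ⟨y, hy, hxy⟩ := hM' x hx
    exact AddSubgroup.mem_sup_of_normal_right.2
      ⟨2 • y, htwo y hy, -(2 • y) + x, E.proj_eq_proj.1 hxy.symm, add_neg_cancel_left _ _⟩

end CyclicStep

theorem OrderStep.exists_cyclicStep {I K J : BraceIdeal B} (hK : OrderStep 2 I K)
    (h : CyclicStep K J) : ∃ M M', CyclicStep I M ∧ OrderStep 2 M M' ∧ OrderStep 2 M' J := by
  obtain ⟨J, rfl⟩ := exists_comap_eq (hK.le.trans h.le)
  obtain ⟨K, rfl⟩ := exists_comap_eq hK.le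
  rw [orderStep_comap_right] at hK
  rw [cyclicStep_comap] at h
  obtain ⟨M, M', hM, hsum, hM'⟩ := h.exists_isDirectSum_of_natCard_eq_two (orderStep_bot.1 hK)
  exact ⟨I.comap M, I.comap M', cyclicStep_comap_right.2 hM,
    orderStep_comap.2 (hsum.symm.orderStep_iff.2 hK), orderStep_comap.2 hM'⟩

/-- `I` and `J` are joined by a chain of ideals whose factors have order two. -/
abbrev TwoChain : BraceIdeal B → BraceIdeal B → Prop := Relation.ReflTransGen (OrderStep 2)

namespace TwoChain

variable {I K J : BraceIdeal B}

theorem exists_cyclicStep (h : TwoChain I K) (hJ : CyclicStep K J) :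
    ∃ M, CyclicStep I M ∧ TwoChain M J := by
  induction h using Relation.ReflTransGen.head_induction_on with
  | refl => exact ⟨J, hJ, .refl⟩
  | head h _ ih =>
    obtain ⟨M, hM, hMJ⟩ := ih
    obtain ⟨M₁, M₂, hM₁, h₁₂, h₂⟩ := h.exists_cyclicStep hM
    exact ⟨M₁, hM₁, .head h₁₂ (.head h₂ hMJ)⟩

theorem le (h : TwoChain I J) : I ≤ J := by
  induction h with
  | refl => exact le_rfl
  | tail _ h ih => exact ih.trans h.le

theorem exists_relIndex_eq (h : TwoChain I J) :
    ∃ k : ℕ, I.toAddSubgroup.relIndex J.toAddSubgroup = 2 ^ k := by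
  induction h with
  | refl => exact ⟨0, AddSubgroup.relIndex_self _⟩
  | tail hI h ih =>
    obtain ⟨k, hk⟩ := ih
    exact ⟨k + 1, by
      rw [← AddSubgroup.relIndex_mul_relIndex _ _ _ (TwoChain.le hI) h.le, hk, h.relIndex_eq,
        pow_succ]⟩

end TwoChain

/-- An infinite cyclic factor on top of a chain of factors of order two can be moved below that
chain, up to further factors of order two, and then replaced by its doubles, which are congruent
to squares. -/
theorem exists_twoChain_le {J : BraceIdeal B} (h : Relation.ReflTransGen CyclicOrTwoStep ⊥ J)
    {H : Subgroup B} (hH : ∀ x, x * x ∈ H) :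
    ∃ N : BraceIdeal B, (∀ x ∈ N, x ∈ H) ∧ TwoChain N J := by
  induction h with
  | refl =>
    refine ⟨⊥, fun x hx => ?_, .refl⟩
    rw [mem_bot.1 hx, ← one_eq_zero]
    exact H.one_mem
  | tail _ h ih =>
    obtain ⟨N, hN, hNK⟩ := ih
    rcases h with h | h
    · obtain ⟨M, hNM, hMJ⟩ := hNK.exists_cyclicStep h
      obtain ⟨N', -, hN'M, hN'⟩ := hNM.exists_orderStep_two
      refine ⟨N', fun x hx => ?_, .head hN'M hMJ⟩
      obtain ⟨y, hy, hxy⟩ := hN' x hx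
      have hlam := (proj_mem_socle_iff.1 (hNM.proj_mem_socle y hy) y).1
      have hyy : N.proj (y * y) = N.proj x := by
        rw [hxy, mul_eq_add_lam, map_add, hlam, ← map_add, two_nsmul]
      rw [← mul_inv_cancel_left (y * y) x]
      exact H.mul_mem (hH y) (hN _ (N.proj_eq_proj_mul.1 hyy))
    · exact ⟨N, hN, hNK.tail h⟩

/-! ### Central nilpotency and the Fitting ideal -/

variable (B) in
/-- The elements of `(B, *)` acting trivially on every infinite cyclic socle factor of `B`. -/
def cyclicStepFixer : Subgroup B :=
  ⨅ (I : BraceIdeal B) (J : BraceIdeal B) (_ : CyclicStep I J), lamFixer I J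

theorem mem_cyclicStepFixer {b : B} :
    b ∈ cyclicStepFixer B ↔ ∀ I J : BraceIdeal B, CyclicStep I J → b ∈ lamFixer I J := by
  simp only [cyclicStepFixer, Subgroup.mem_iInf]

/-- The elements of `J` are, modulo `I`, central in `N`. -/
structure CentralStep (N I J : BraceIdeal B) : Prop where
  le : I ≤ J
  proj_lam : ∀ x ∈ J, ∀ y ∈ N, I.proj (lam x y) = I.proj y
  proj_add : ∀ x ∈ J, ∀ y ∈ N, I.proj (y + x) = I.proj (x + y)
  proj_mul : ∀ x ∈ J, ∀ y ∈ N, I.proj (y * x) = I.proj (x * y)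

theorem OrderStep.proj_mem_zeta {I J : BraceIdeal B} (h : OrderStep 2 I J) {x : B} (hx : x ∈ J) :
    I.proj x ∈ zeta I.Quot := by
  obtain ⟨J, rfl⟩ := exists_comap_eq h.le
  exact subset_zeta_of_natCard_eq_two (orderStep_bot.1 (orderStep_comap_right.1 h)) hx

theorem OrderStep.centralStep {I J : BraceIdeal B} (h : OrderStep 2 I J) (N : BraceIdeal B) :
    CentralStep N I J where
  le := h.le
  proj_lam _ hx y _ := (proj_mem_socle_iff.1 (h.proj_mem_zeta hx).1 y).1
  proj_add _ hx y _ := (proj_mem_socle_iff.1 (h.proj_mem_zeta hx).1 y).2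
  proj_mul _ hx y _ := (mem_zeta.1 (h.proj_mem_zeta hx)).2 (I.proj y)

theorem CyclicStep.centralStep {I J N : BraceIdeal B} (h : CyclicStep I J)
    (hN : ∀ b ∈ N, b ∈ lamFixer I J) : CentralStep N I J where
  le := h.le
  proj_lam x hx y _ := (proj_mem_socle_iff.1 (h.proj_mem_socle x hx) y).1
  proj_add x hx y _ := (proj_mem_socle_iff.1 (h.proj_mem_socle x hx) y).2
  proj_mul x hx y hy := by
    obtain ⟨hlam, hadd⟩ := proj_mem_socle_iff.1 (h.proj_mem_socle x hx) y
    rw [mul_eq_add_lam, mul_eq_add_lam, map_add, map_add, hN y hy x hx, hlam, ← map_add, hadd,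
      map_add]

theorem CentralStep.inf {N I J : BraceIdeal B} (h : CentralStep N I J) :
    CentralStep N (N ⊓ I) (N ⊓ J) := by
  have hproj : ∀ {a b : B}, a ∈ N → b ∈ N → I.proj a = I.proj b →
      (N ⊓ I).proj a = (N ⊓ I).proj b := fun ha hb hab =>
    (N ⊓ I).proj_eq_proj.2 ⟨N.add_mem (N.neg_mem ha) hb, I.proj_eq_proj.1 hab⟩
  exact ⟨inf_le_inf_left N h.le,
    fun x hx y hy => hproj (N.lam_mem x hy) hy (h.proj_lam x hx.2 y hy),
    fun x hx y hy => hproj (N.add_mem hy hx.1) (N.add_mem hx.1 hy) (h.proj_add x hx.2 y hy),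
    fun x hx y hy => hproj (N.mul_mem hy hx.1) (N.mul_mem hx.1 hy) (h.proj_mul x hx.2 y hy)⟩

theorem isBCentrallyNilpotent_of_reflTransGen {N : BraceIdeal B}
    (h : Relation.ReflTransGen (CentralStep N) ⊥ N) : N.IsBCentrallyNilpotent := by
  obtain ⟨n, c, h0, hn, hc⟩ := exists_chain_of_reflTransGen h
  refine ⟨n, c, by rw [h0]; rfl, hn, fun i hi => ⟨(hc i hi).le, fun x hx => ?_⟩⟩
  set P := (c i).restrict N
  have hproj : ∀ a b : N, (c i).proj a = (c i).proj b → P.proj a = P.proj b := fun a b hab =>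
    P.proj_eq_proj.2 ((c i).proj_eq_proj.1 hab)
  refine mem_zeta.2 ⟨proj_mem_socle_iff.2 fun y => ⟨hproj _ _ ?_, hproj _ _ ?_⟩,
    P.proj_surjective.forall.2 fun y => hproj _ _ ?_⟩
  · exact (hc i hi).proj_lam x hx y y.2
  · exact (hc i hi).proj_add x hx y y.2
  · exact (hc i hi).proj_mul x hx y y.2

theorem isBCentrallyNilpotent_of_le_cyclicStepFixer {N : BraceIdeal B}
    (hN : ∀ b ∈ N, b ∈ cyclicStepFixer B)
    (h : Relation.ReflTransGen CyclicOrTwoStep (⊥ : BraceIdeal B) ⊤) :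
    N.IsBCentrallyNilpotent := by
  have hstep : ∀ I J : BraceIdeal B, CyclicOrTwoStep I J → CentralStep N (N ⊓ I) (N ⊓ J) := by
    rintro I J (h | h)
    · exact (h.centralStep fun b hb => mem_cyclicStepFixer.1 (hN b hb) I J h).inf
    · exact (h.centralStep N).inf
  have hchain : Relation.ReflTransGen (CentralStep N) (N ⊓ ⊥) (N ⊓ ⊤) := h.lift (N ⊓ ·) hstep
  rw [inf_bot_eq, inf_top_eq] at hchain
  exact isBCentrallyNilpotent_of_reflTransGen hchain

theorem exists_natCard_quot_fit_eq
    (h : Relation.ReflTransGen CyclicOrTwoStep (⊥ : BraceIdeal B) ⊤) :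
    ∃ n : ℕ, Nat.card (fit B).Quot = 2 ^ n := by
  obtain ⟨N, hN, hchain⟩ := exists_twoChain_le h fun x =>
    mem_cyclicStepFixer.2 fun _ _ hIJ => hIJ.mul_self_mem_lamFixer x
  have hle : N.toAddSubgroup ≤ (fit B).toAddSubgroup := fun _ hx =>
    le_fit (isBCentrallyNilpotent_of_le_cyclicStepFixer hN h) hx
  obtain ⟨k, hk⟩ := hchain.exists_relIndex_eq
  have hindex : N.toAddSubgroup.index = 2 ^ k := (AddSubgroup.relIndex_top_right _).symm.trans hk
  obtain ⟨n, -, hn⟩ :=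
    (Nat.dvd_prime_pow Nat.prime_two).1 (hindex ▸ AddSubgroup.index_dvd_of_le hle)
  exact ⟨n, hn⟩

theorem cyclicStep_of_factor {I J : BraceIdeal B} (hIJ : I ≤ J) [Infinite (J.factor I)]
    [hcyc : IsAddCyclic (J.factor I)] (hsoc : (J.factor I : Set I.Quot) ⊆ socle I.Quot) :
    CyclicStep I J := by
  obtain ⟨⟨_, g, hg, rfl⟩, hgen⟩ := hcyc.exists_generator
  have hfactor : ∀ x ∈ J, I.proj x ∈ J.factor I := fun x hx => ⟨x, hx, rfl⟩
  have hord := Infinite.addOrderOf_eq_zero_of_forall_mem_zmultiples hgen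
  refine ⟨hIJ, ⟨g, hg, fun n hn => ?_, fun x hx => ?_⟩, fun x hx => hsoc (hfactor x hx)⟩
  · rw [← proj_eq_zero, map_zsmul] at hn
    exact addOrderOf_eq_zero_iff_forall_zsmul.1 hord n (Subtype.ext hn)
  · obtain ⟨n, hn⟩ := AddSubgroup.mem_zmultiples_iff.1 (hgen ⟨_, hfactor x hx⟩)
    exact ⟨n, (map_zsmul _ _ _).trans (congrArg Subtype.val hn)⟩

end BraceIdeal

open BraceIdeal

theorem IsSupersoluble.reflTransGen_cyclicOrTwoStep (h : IsSupersoluble B)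
    (htors : ∀ p : ℕ, p.Prime → p ≠ 2 → ∀ x : B, p • x = 0 → x = 0) :
    Relation.ReflTransGen CyclicOrTwoStep (⊥ : BraceIdeal B) ⊤ := by
  obtain ⟨n, c, h0, hn, hc⟩ := h
  have hbot : c 0 = ⊥ := SetLike.coe_injective h0
  have htop : c n = ⊤ := SetLike.coe_injective hn
  have hchain : ∀ i ≤ n, Relation.ReflTransGen CyclicOrTwoStep ⊥ (c i) := by
    intro i hi
    induction i with
    | zero => rw [hbot]
    | succ i ih =>
      have hci := ih (Nat.le_of_succ_le hi)
      obtain ⟨hle, ⟨_, _, hsoc⟩ | hp⟩ := hc i hi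
      · exact hci.tail (.inl (cyclicStep_of_factor hle hsoc))
      · have hstep : OrderStep _ (c i) (c (i + 1)) := ⟨hle, relIndex_eq_natCard_factor _ _⟩
        rcases eq_or_ne (Nat.card ((c (i + 1)).factor (c i))) 2 with hp2 | hp2
        · exact hci.tail (.inr (hp2 ▸ hstep))
        · exact hstep.reflTransGen_cyclicOrTwoStep hp (hp.odd_of_ne_two hp2) (htors _ hp hp2) hci
  exact htop ▸ hchain n le_rfl

theorem eq_zero_of_nsmul_eq_zero_of_addU_two (h : addU B 2 = {0}) {p : ℕ} (hp : p.Prime)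
    (hp2 : p ≠ 2) {x : B} (hx : p • x = 0) : x = 0 := by
  have hmem : x ∈ addU B 2 := by
    refine ⟨isOfFinAddOrder_iff_nsmul_eq_zero.2 ⟨p, hp.pos, hx⟩, fun q hq hqx => ?_⟩
    rw [(Nat.prime_dvd_prime_iff_eq hq hp).1 (hqx.trans (addOrderOf_dvd_of_nsmul_eq_zero hx))]
    exact lt_of_le_of_ne hp.two_le hp2.symm
  rwa [h] at hmem

end SkewBrace

theorem theorem3p40 (B : Type*) [SkewBrace B] (hB : SkewBrace.IsSupersoluble B) :
    (SkewBrace.addU B 2 = {0} →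
      ∃ n : ℕ, Nat.card (SkewBrace.BraceIdeal.fit B).Quot = 2 ^ n) ∧
    ((∀ b : B, IsOfFinAddOrder b → b = 0) →
      ∃ n : ℕ, Nat.card (SkewBrace.BraceIdeal.fit B).Quot = 2 ^ n) := by
  have hcard (htors : ∀ p : ℕ, p.Prime → p ≠ 2 → ∀ x : B, p • x = 0 → x = 0) :
      ∃ n : ℕ, Nat.card (SkewBrace.BraceIdeal.fit B).Quot = 2 ^ n :=
    SkewBrace.BraceIdeal.exists_natCard_quot_fit_eq (hB.reflTransGen_cyclicOrTwoStep htors)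
  exact ⟨fun hU => hcard fun _ hp hp2 _ =>
      SkewBrace.eq_zero_of_nsmul_eq_zero_of_addU_two hU hp hp2,
    fun hfree => hcard fun p hp _ x hx =>
      hfree x (isOfFinAddOrder_iff_nsmul_eq_zero.2 ⟨p, hp.pos, hx⟩)⟩
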